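/- Let $k$ be an infinite field and let $S=\bigoplus_{n\ge 0}S_n$ be a standard graded $k$-algebra, i.e. a commutative $\mathbb{N}$-graded $k$-algebra that is finitely generated as a $k$-algebra, with $S_0=k$ and $S=k[S_1]$. Suppose that $S$ has Krull dimension $d\ge 1$. For a $k$-subalgebra $A\subseteq S$, say that the inclusion $A\subseteq S$ is a graded Noether normalization if $A$ is a polynomial ring over $k$ in $d=\dim S$ variables that are homogeneous elements of degree $1$ of $S$ (i.e. $A$ is generated over $k$ by $d$ elements of $S_1$ that are algebraically independent over $k$), and $S$ is finitely generated as an $A$-module. Let $X_1,\dots,X_d,Y_1,\dots,Y_d\in S_1$ be such that $k[X_1,\dots,X_d]\subseteq S$ and $k[Y_1,\dots,Y_d]\subseteq S$ are graded Noether normalizations of $S$. Then there is a proper subset $M\subsetneq k^d$ which is a finite union of $k$-linear subspaces of $k^d$, such that for every $c=(c_1,\dots,c_d)\in k^d$ we have $c\notin M$ if and only if the inclusion $k[X_1,\dots,X_{d-1},\sum_{j=1}^d c_jY_j]\subseteq S$ is a graded Noether normalization. -/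

import Mathlib

/-- An `ℕ`-graded algebra `S` over a field `k`, with graded pieces `𝒮 n`, is *standard graded* if
it is finitely generated as a `k`-algebra, `𝒮 0 = k` and `S = k[𝒮 1]`. -/
structure IsStandardGraded {k S : Type*} [Field k] [CommRing S] [Algebra k S]
    (𝒮 : ℕ → Submodule k S) [GradedAlgebra 𝒮] : Prop where
  finiteType : Algebra.FiniteType k S
  /-- The structure map `k → 𝒮 0` is a bijection. -/
  zero_eq : ∀ s ∈ 𝒮 0, ∃! a : k, algebraMap k S a = s
  adjoin_one : Algebra.adjoin k (𝒮 1 : Set S) = ⊤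

/-- The inclusion `A ⊆ S` of a `k`-subalgebra is a *graded Noether normalization*: `A` is a
polynomial ring over `k` in `dim S` variables, all of which are homogeneous of degree one in `S`
(so that the inclusion is graded), and `S` is finitely generated as an `A`-module. -/
structure IsGradedNoetherNormalization {k S : Type*} [Field k] [CommRing S] [Algebra k S]
    (𝒮 : ℕ → Submodule k S) [GradedAlgebra 𝒮] (A : Subalgebra k S) : Prop where
  exists_variables : ∃ (n : ℕ) (v : Fin n → S), ringKrullDim S = (n : WithBot ℕ∞) ∧
    (∀ i, v i ∈ 𝒮 1) ∧ AlgebraicIndependent k v ∧ Algebra.adjoin k (Set.range v) = A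
  finite : Module.Finite A S

/-- A *subspace arrangement* in a `k`-vector space is a finite union of linear subspaces. -/
def IsSubspaceArrangement (k : Type*) {V : Type*} [Field k] [AddCommGroup V] [Module k V]
    (M : Set V) : Prop :=
  ∃ W : Set (Submodule k V), W.Finite ∧ M = ⋃ w ∈ W, (w : Set V)

open HomogeneousIdeal

section
variable {k S : Type*} [Field k] [CommRing S] [Algebra k S]
  {𝒮 : ℕ → Submodule k S} [GradedAlgebra 𝒮]

/-! Let `m` be the irrelevant ideal. For `d = dim S` linear forms, being a graded Noether
normalization means that every minimal prime of the ideal they generate contains `m`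
(`isGradedNoetherNormalization_iff`). Put `I = (X_1, …, X_{d-1})` and `y = ∑ c_j Y_j`. The set `M`
is the union, over the minimal primes `P ≠ m` of `I`, of the subspaces `{c | y ∈ P}`. Each is
proper: a homogeneous prime containing all `Y_j` contains `m`. If `y` avoids these `P`, a minimal
prime of `I + (y)` is either `m` or lies strictly above such a `P`. As `m` is minimal over `I +
(X_d)`, Krull's principal ideal theorem modulo `I` leaves no room strictly between `P` and `m`. -/

theorem IsStandardGraded.piece_le_pow (hS : IsStandardGraded 𝒮) (n : ℕ) : 𝒮 n ≤ (𝒮 1) ^ n := by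
  have key : ∀ x : S, ∀ n, (DirectSum.decompose 𝒮 x n : S) ∈ (𝒮 1) ^ n := by
    intro x
    have hx : x ∈ Subalgebra.toSubmodule (Algebra.adjoin k (𝒮 1 : Set S)) := by
      rw [hS.adjoin_one]; trivial
    rw [Algebra.adjoin_eq_span] at hx
    induction hx using Submodule.span_induction with
    | mem x hx =>
      induction hx using Submonoid.closure_induction_left with
      | one =>
        intro n
        rcases Nat.eq_zero_or_pos n with rfl | hn
        · rw [DirectSum.decompose_of_mem_same 𝒮 SetLike.GradedOne.one_mem, pow_zero]
          exact Submodule.one_le.mp le_rfl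
        · rw [DirectSum.decompose_of_mem_ne 𝒮 SetLike.GradedOne.one_mem hn.ne]
          exact zero_mem _
      | mul_left s hs y _ ih =>
        intro n
        rcases n with _ | n
        · rw [DirectSum.coe_decompose_mul_of_left_mem_of_not_le 𝒮 hs (by simp)]
          exact zero_mem _
        · rw [DirectSum.coe_decompose_mul_of_left_mem_of_le 𝒮 hs (by simp), pow_succ']
          exact Submodule.mul_mem_mul hs (ih _)
    | zero => simp
    | add x y _ _ hx hy =>
      intro n
      rw [DirectSum.decompose_add]
      exact add_mem (hx n) (hy n)
    | smul a x _ hx =>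
      intro n
      rw [DirectSum.decompose_smul]
      exact Submodule.smul_mem _ a (hx n)
  intro x hx
  simpa [DirectSum.decompose_of_mem_same 𝒮 hx] using key x n

theorem IsStandardGraded.isNoetherianRing (hS : IsStandardGraded 𝒮) : IsNoetherianRing S :=
  have := hS.finiteType
  Algebra.FiniteType.isNoetherianRing k S

theorem IsStandardGraded.piece_fg (hS : IsStandardGraded 𝒮) (n : ℕ) : (𝒮 n).FG := by
  have := hS.isNoetherianRing
  have h1 : (𝒮 1).FG := by
    obtain ⟨t, ht, htspan⟩ := (Submodule.fg_span_iff_fg_span_finset_subset (R := S)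
      (𝒮 1 : Set S)).mp (IsNoetherian.noetherian _)
    refine ⟨t, le_antisymm (Submodule.span_le.mpr ht) fun x hx => ?_⟩
    have hx' : x ∈ Submodule.span S (t : Set S) := htspan ▸ Submodule.subset_span hx
    obtain ⟨a, ha⟩ := Submodule.mem_span_finset'.mp hx'
    -- Comparing degree-one components replaces the coefficients by their degree-zero parts, which
    -- are scalars.
    rw [← DirectSum.decompose_of_mem_same 𝒮 hx, ← ha, DirectSum.decompose_sum,
      DFinsupp.finsetSum_apply, AddSubmonoidClass.coe_finsetSum]
    refine sum_mem fun i _ => ?_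
    rw [smul_eq_mul, DirectSum.coe_decompose_mul_of_right_mem_of_le 𝒮 (ht i.2) le_rfl]
    obtain ⟨b, hb, -⟩ := hS.zero_eq _ (DirectSum.decompose 𝒮 (a i) (1 - 1)).2
    rw [← hb, ← Algebra.smul_def]
    exact Submodule.smul_mem _ _ (Submodule.subset_span i.2)
  have hn : 𝒮 n = (𝒮 1) ^ n := le_antisymm (hS.piece_le_pow n) <| by
    induction n with
    | zero =>
      rw [pow_zero, Submodule.one_le]
      exact SetLike.GradedOne.one_mem
    | succ n ih =>
      rw [pow_succ, Submodule.mul_le]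
      exact fun x hx y hy => SetLike.GradedMul.mul_mem (ih hx) hy
  rw [hn]
  exact h1.pow n

/-! ### Criterion for a graded Noether normalization -/

/-- Some power `m ^ N` lies in `(v)`, so a form of degree above `N` is `∑ a_i v_i` with each `a_i`
of degree one less. By induction the pieces of degree at most `N` generate `S`. -/
theorem IsStandardGraded.finite_adjoin (hS : IsStandardGraded 𝒮) {ι : Type*} [Fintype ι]
    {v : ι → S} (hv : ∀ i, v i ∈ 𝒮 1)
    (h : (irrelevant 𝒮).toIdeal ≤ (Ideal.span (Set.range v)).radical) :
    Module.Finite (Algebra.adjoin k (Set.range v)) S := by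
  have := hS.isNoetherianRing
  obtain ⟨N, hN⟩ := Ideal.exists_pow_le_of_le_radical_of_fg h (IsNoetherian.noetherian _)
  have hpow (n : ℕ) (x : S) (hx : x ∈ (𝒮 1) ^ n) : x ∈ (irrelevant 𝒮).toIdeal ^ n := by
    induction hx using Submodule.pow_induction_on_left' with
    | algebraMap r => simp
    | add x y i _ _ hx hy => exact add_mem hx hy
    | mem_mul m hm i x _ hx =>
      rw [pow_succ']
      exact Ideal.mul_mem_mul (mem_irrelevant_of_mem 𝒮 one_pos hm) hx
  set A := Algebra.adjoin k (Set.range v)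
  set W : Submodule k S := ⨆ i : Fin (N + 1), 𝒮 i
  have hW : W.FG := Submodule.fg_iSup _ fun i => hS.piece_fg i
  have hle (n : ℕ) : ∀ x ∈ 𝒮 n, x ∈ Submodule.span A (W : Set S) := by
    induction n with
    | zero =>
      exact fun x hx => Submodule.subset_span (Submodule.mem_iSup_of_mem (0 : Fin (N + 1)) hx)
    | succ n ih =>
      intro x hx
      rcases lt_or_ge (n + 1) (N + 1) with hn | hn
      · exact Submodule.subset_span (Submodule.mem_iSup_of_mem (⟨n + 1, hn⟩ : Fin (N + 1)) hx)
      have hxJ : x ∈ Ideal.span (Set.range v) :=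
        hN (Ideal.pow_le_pow_right (N.le_succ.trans hn) (hpow _ x (hS.piece_le_pow _ hx)))
      obtain ⟨a, ha⟩ := (Ideal.mem_span_range_iff_exists_fun).mp hxJ
      rw [← DirectSum.decompose_of_mem_same 𝒮 hx, ← ha, DirectSum.decompose_sum,
        DFinsupp.finsetSum_apply, AddSubmonoidClass.coe_finsetSum]
      refine sum_mem fun i _ => ?_
      rw [DirectSum.coe_decompose_mul_of_right_mem_of_le 𝒮 (hv i) (by simp), mul_comm]
      exact Submodule.smul_mem _ (⟨v i, Algebra.subset_adjoin ⟨i, rfl⟩⟩ : A)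
        (ih _ (DirectSum.decompose 𝒮 (a i) (n + 1 - 1)).2)
  obtain ⟨t, ht⟩ := hW
  refine ⟨⟨t, eq_top_iff.mpr fun x _ => ?_⟩⟩
  have hWt : Submodule.span A (W : Set S) ≤ Submodule.span A (t : Set S) := by
    rw [← ht, Submodule.span_le]
    exact Submodule.span_subset_span k A _
  classical
  rw [← DirectSum.sum_support_decompose 𝒮 x]
  exact sum_mem fun i _ => hWt (hle i _ (DirectSum.decompose 𝒮 x i).2)

/-- Integrality gives `dim S ≤ dim A`, while a nontrivial relation among the `d` generators would
force `dim A < d`. -/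
theorem AlgebraicIndependent.of_finite_adjoin {d : ℕ} (hdim : ringKrullDim S = d) (v : Fin d → S)
    (hfin : Module.Finite (Algebra.adjoin k (Set.range v)) S) : AlgebraicIndependent k v := by
  set A := Algebra.adjoin k (Set.range v)
  have hSA : ringKrullDim S ≤ ringKrullDim A :=
    Order.krullDim_le_of_strictMono (PrimeSpectrum.comap (algebraMap A S)) fun p q hpq =>
      Ideal.IsIntegral.comap_lt_comap hpq
  rw [algebraicIndependent_iff]
  by_contra! ⟨p, hp, hp0⟩
  let f : MvPolynomial (Fin d) k →ₐ[k] A :=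
    MvPolynomial.aeval fun i => ⟨v i, Algebra.subset_adjoin ⟨i, rfl⟩⟩
  have hval : A.val.comp f = MvPolynomial.aeval v := by
    ext i; simp [f]
  have hf : Function.Surjective f := by
    rintro ⟨a, ha⟩
    replace ha : a ∈ (A.val.comp f).range := by
      rwa [hval, ← Algebra.adjoin_range_eq_range_aeval]
    obtain ⟨q, hq⟩ := ha
    exact ⟨q, Subtype.ext hq⟩
  have := ringKrullDim_succ_le_of_surjective f.toRingHom hf (mem_nonZeroDivisors_of_ne_zero hp0)
    (Subtype.ext (by simpa [← hval] using hp))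
  rw [MvPolynomial.ringKrullDim_of_isNoetherianRing, ringKrullDim_eq_zero_of_field] at this
  have h2 := (add_le_add_left hSA 1).trans this
  rw [hdim] at h2
  norm_num at h2
  norm_cast at h2
  omega

theorem Ideal.IsHomogeneous.of_mem_minimalPrimes {I P : Ideal S} (hI : I.IsHomogeneous 𝒮)
    (hP : P ∈ I.minimalPrimes) : P.IsHomogeneous 𝒮 := by
  have hle := Ideal.toIdeal_homogeneousCore_le 𝒮 P
  have hI' : I ≤ (P.homogeneousCore 𝒮).toIdeal := by
    rw [← hI.toIdeal_homogeneousCore_eq_self]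
    exact Ideal.homogeneousCore_mono 𝒮 hP.1.2
  have := hP.2 ⟨Ideal.IsPrime.homogeneousCore hP.1.1, hI'⟩ hle
  rw [← le_antisymm hle this]
  exact HomogeneousIdeal.isHomogeneous _

theorem IsStandardGraded.le_irrelevant (hS : IsStandardGraded 𝒮) {P : Ideal S}
    (hP : P.IsHomogeneous 𝒮) (htop : P ≠ ⊤) : P ≤ (irrelevant 𝒮).toIdeal := by
  intro x hx
  obtain ⟨a, ha, -⟩ := hS.zero_eq _ (DirectSum.decompose 𝒮 x 0).2
  change (DirectSum.decompose 𝒮 x 0 : S) = 0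
  rw [← ha]
  by_contra hne
  have ha0 : a ≠ 0 := fun h => hne (by simp [h])
  exact htop (Ideal.eq_top_of_isUnit_mem P (ha ▸ hP 0 hx) ((IsUnit.mk0 a ha0).map (algebraMap k S)))

theorem IsStandardGraded.irrelevant_isPrime [Nontrivial S] (hS : IsStandardGraded 𝒮) :
    (irrelevant 𝒮).toIdeal.IsPrime := by
  refine (HomogeneousIdeal.isHomogeneous _).isPrime_of_homogeneous_mem_or_mem ?_ ?_
  · rw [Ideal.ne_top_iff_one]
    change ¬ (DirectSum.decompose 𝒮 (1 : S) 0 : S) = 0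
    rw [DirectSum.decompose_of_mem_same 𝒮 SetLike.GradedOne.one_mem]
    exact one_ne_zero
  · rintro x y ⟨i, hx⟩ ⟨j, hy⟩ hxy
    rcases Nat.eq_zero_or_pos i with rfl | hi
    · rcases Nat.eq_zero_or_pos j with rfl | hj
      · obtain ⟨a, rfl, -⟩ := hS.zero_eq _ hx
        by_cases ha : a = 0
        · left; simp [ha]
        · right
          exact (Ideal.unit_mul_mem_iff_mem _ ((IsUnit.mk0 a ha).map (algebraMap k S))).mp hxy
      · exact .inr (mem_irrelevant_of_mem 𝒮 hj hy)
    · exact .inl (mem_irrelevant_of_mem 𝒮 hi hx)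

/-- Modulo `P` the subalgebra collapses to scalars, so a form `x` of positive degree satisfies a
monic equation over `k` modulo `P`. Homogeneity of `P` isolates the leading power of `x`. -/
theorem irrelevant_le_of_finite_adjoin {s : Set S} {P : Ideal S}
    (hP : P.IsHomogeneous 𝒮) [hprime : P.IsPrime] (hs : s ⊆ P)
    (hfin : Module.Finite (Algebra.adjoin k s) S) : (irrelevant 𝒮).toIdeal ≤ P := by
  rw [toIdeal_irrelevant_le]
  intro n hn x hx
  have hmod (a : S) (ha : a ∈ Algebra.adjoin k s) : ∃ c : k, a - algebraMap k S c ∈ P := by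
    induction ha using Algebra.adjoin_induction with
    | mem x hx => exact ⟨0, by simpa using hs hx⟩
    | algebraMap r => exact ⟨r, by simp⟩
    | add x y _ _ hx hy =>
      obtain ⟨a, ha⟩ := hx
      obtain ⟨b, hb⟩ := hy
      exact ⟨a + b, by simpa [add_sub_add_comm] using add_mem ha hb⟩
    | mul x y _ _ hx hy =>
      obtain ⟨a, ha⟩ := hx
      obtain ⟨b, hb⟩ := hy
      refine ⟨a * b, ?_⟩
      have : x * y - algebraMap k S (a * b) =
          y * (x - algebraMap k S a) + algebraMap k S a * (y - algebraMap k S b) := by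
        rw [map_mul]; ring
      rw [this]
      exact add_mem (P.mul_mem_left _ ha) (P.mul_mem_left _ hb)
  obtain ⟨q, hq, hqx⟩ := Algebra.IsIntegral.isIntegral (R := Algebra.adjoin k s) x
  choose c hc using fun i => hmod (q.coeff i) (q.coeff i).2
  have hsum : x ^ q.natDegree + ∑ i ∈ Finset.range q.natDegree, c i • x ^ i ∈ P := by
    have h0 : (0 : S) =
        x ^ q.natDegree + ∑ i ∈ Finset.range q.natDegree, (q.coeff i : S) * x ^ i := by
      rw [← hqx, Polynomial.eval₂_eq_sum_range, Finset.sum_range_succ, hq.coeff_natDegree]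
      simp [add_comm]
    have : x ^ q.natDegree + ∑ i ∈ Finset.range q.natDegree, c i • x ^ i =
        -∑ i ∈ Finset.range q.natDegree, (x ^ i * ((q.coeff i : S) - algebraMap k S (c i))) := by
      rw [← sub_eq_zero, sub_neg_eq_add, add_assoc, ← Finset.sum_add_distrib, h0]
      congr 1
      refine Finset.sum_congr rfl fun i _ => ?_
      rw [Algebra.smul_def]; ring
    rw [this]
    exact neg_mem (sum_mem fun i _ => P.mul_mem_left _ (hc i))
  -- The lower terms sit in degrees `n * i < n * q.natDegree`, so only the leading power survives
  -- here.
  have hdeg := hP (n * q.natDegree) hsum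
  have hxp (i : ℕ) : x ^ i ∈ 𝒮 (n * i) := by
    simpa [mul_comm] using SetLike.pow_mem_graded (A := 𝒮) i hx
  rw [DirectSum.decompose_add, DirectSum.add_apply, AddMemClass.coe_add,
    DirectSum.decompose_of_mem_same 𝒮 (hxp _), DirectSum.decompose_sum, DFinsupp.finsetSum_apply, AddSubmonoidClass.coe_finsetSum,
    Finset.sum_eq_zero, add_zero] at hdeg
  · exact hprime.mem_of_pow_mem _ hdeg
  · intro i hi
    refine DirectSum.decompose_of_mem_ne 𝒮 (Submodule.smul_mem _ _ (hxp i)) ?_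
    exact (Nat.mul_lt_mul_of_pos_left (Finset.mem_range.mp hi) hn).ne

theorem IsStandardGraded.isGradedNoetherNormalization_iff (hS : IsStandardGraded 𝒮) {d : ℕ}
    (hdim : ringKrullDim S = d) {v : Fin d → S} (hv : ∀ i, v i ∈ 𝒮 1) :
    IsGradedNoetherNormalization 𝒮 (Algebra.adjoin k (Set.range v)) ↔
      ∀ P ∈ (Ideal.span (Set.range v)).minimalPrimes, (irrelevant 𝒮).toIdeal ≤ P := by
  constructor
  · intro h P hP
    have hhom : (Ideal.span (Set.range v)).IsHomogeneous 𝒮 :=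
      Ideal.homogeneous_span 𝒮 _ (by rintro _ ⟨i, rfl⟩; exact ⟨1, hv i⟩)
    have := hP.1.1
    exact irrelevant_le_of_finite_adjoin (hhom.of_mem_minimalPrimes hP)
      (Ideal.subset_span.trans hP.1.2) h.finite
  · intro h
    have hfin : Module.Finite (Algebra.adjoin k (Set.range v)) S := by
      refine hS.finite_adjoin hv ?_
      rw [← Ideal.sInf_minimalPrimes]
      exact le_sInf h
    exact ⟨⟨d, v, hdim, hv, .of_finite_adjoin hdim v hfin, rfl⟩, hfin⟩

/-! ### Krull's principal ideal theorem and the exchange of one variable -/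

theorem Ideal.eq_of_lt_of_le_of_mem_minimalPrimes_sup_span_singleton {R : Type*} [CommRing R]
    [IsNoetherianRing R] {I p q m : Ideal R} {x : R} (hm : m ∈ (I ⊔ Ideal.span {x}).minimalPrimes)
    [p.IsPrime] [hq : q.IsPrime] (hIp : I ≤ p) (hpq : p < q) (hqm : q ≤ m) : q = m := by
  by_contra hne
  have hlt : q < m := lt_of_le_of_ne hqm hne
  have hmp : m.IsPrime := hm.1.1
  have hmap {a b : Ideal R} (ha : I ≤ a) (hb : I ≤ b) (hab : a < b) :
      a.map (Ideal.Quotient.mk I) < b.map (Ideal.Quotient.mk I) := by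
    refine lt_of_le_of_ne (Ideal.map_mono hab.le) fun h => hab.ne ?_
    have := congrArg (Ideal.comap (Ideal.Quotient.mk I)) h
    rwa [Ideal.comap_map_mk ha, Ideal.comap_map_mk hb] at this
  have hprime (a : Ideal R) [a.IsPrime] (ha : I ≤ a) : (a.map (Ideal.Quotient.mk I)).IsPrime :=
    Ideal.map_isPrime_of_surjective Ideal.Quotient.mk_surjective (I.mk_ker.trans_le ha)
  have hIq := hIp.trans hpq.le
  have hIm := hIq.trans hqm
  have := hprime p hIp
  have := hprime q hIq
  have := hprime m hIm
  have h1 := Ideal.map_height_le_one_of_mem_minimalPrimes hm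
  have h2 := Ideal.height_add_one_le_of_lt_of_isPrime (hmap hIq hIm hlt)
  have h3 := Ideal.height_add_one_le_of_lt_of_isPrime (hmap hIp hIq hpq)
  have h4 : (1 : ℕ∞) + 1 ≤ 1 :=
    (add_le_add_left (le_add_self.trans h3) 1).trans (h2.trans h1)
  exact absurd h4 (by decide)

theorem span_range_update {ι : Type*} [DecidableEq ι] (X : ι → S) (l : ι) (y : S) :
    Ideal.span (Set.range (Function.update X l y)) =
      Ideal.span (X '' {l}ᶜ) ⊔ Ideal.span {y} := by
  rw [← Ideal.span_union]
  congr 1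
  ext s
  constructor
  · rintro ⟨i, rfl⟩
    by_cases h : i = l
    · subst h; right; simp
    · left; exact ⟨i, h, by simp [h]⟩
  · rintro (⟨i, hi, rfl⟩ | rfl)
    · exact ⟨i, Function.update_of_ne hi _ _⟩
    · exact ⟨l, Function.update_self ..⟩
end

theorem theorem2p2 {k S : Type*} [Field k] [Infinite k] [CommRing S] [Algebra k S]
    (𝒮 : ℕ → Submodule k S) [GradedAlgebra 𝒮] (hS : IsStandardGraded 𝒮)
    (d : ℕ) (hd : 1 ≤ d) (hdim : ringKrullDim S = (d : WithBot ℕ∞))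
    (X Y : Fin d → S)
    (hX₁ : ∀ i, X i ∈ 𝒮 1)
    (hX : IsGradedNoetherNormalization 𝒮 (Algebra.adjoin k (Set.range X)))
    (hY₁ : ∀ i, Y i ∈ 𝒮 1)
    (hY : IsGradedNoetherNormalization 𝒮 (Algebra.adjoin k (Set.range Y))) :
    ∃ M : Set (Fin d → k), IsSubspaceArrangement k M ∧ M ⊂ Set.univ ∧
      ∀ c : Fin d → k, c ∉ M ↔
        IsGradedNoetherNormalization 𝒮 (Algebra.adjoin k (Set.range
          (Function.update X ⟨d - 1, Nat.sub_one_lt_of_lt hd⟩ (∑ j, c j • Y j)))) := by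
  have := hS.isNoetherianRing
  have : Nontrivial S := by
    by_contra h
    rw [not_nontrivial_iff_subsingleton] at h
    simp [ringKrullDim_eq_bot_of_subsingleton] at hdim
  set l : Fin d := ⟨d - 1, Nat.sub_one_lt_of_lt hd⟩
  set m := (irrelevant 𝒮).toIdeal
  have hm : m.IsPrime := hS.irrelevant_isPrime
  set I : Ideal S := Ideal.span (X '' {l}ᶜ)
  have hI : I.IsHomogeneous 𝒮 :=
    Ideal.homogeneous_span 𝒮 _ (by rintro _ ⟨i, -, rfl⟩; exact ⟨1, hX₁ i⟩)
  have hone {s : S} (hs : s ∈ 𝒮 1) : s ∈ m := mem_irrelevant_of_mem 𝒮 one_pos hs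
  have hmX : m ∈ (I ⊔ Ideal.span {X l}).minimalPrimes := by
    rw [← span_range_update, Function.update_eq_self]
    have hle : Ideal.span (Set.range X) ≤ m :=
      Ideal.span_le.mpr (by rintro _ ⟨i, rfl⟩; exact hone (hX₁ i))
    obtain ⟨P, hP, hPm⟩ := Ideal.exists_minimalPrimes_le hle
    rwa [← le_antisymm hPm ((hS.isGradedNoetherNormalization_iff hdim hX₁).mp hX P hP)]
  have hc₁ (c : Fin d → k) : ∑ j, c j • Y j ∈ 𝒮 1 :=
    sum_mem fun j _ => Submodule.smul_mem _ _ (hY₁ j)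
  let φ : (Fin d → k) →ₗ[k] S := Fintype.linearCombination k Y
  let V : Ideal S → Submodule k (Fin d → k) := fun P => (P.restrictScalars k).comap φ
  have hV (P : Ideal S) (c : Fin d → k) : c ∈ V P ↔ ∑ j, c j • Y j ∈ P := by
    simp [V, φ, Fintype.linearCombination_apply]
  set E : Set (Ideal S) := I.minimalPrimes \ {m}
  have hfin : (V '' E).Finite := (I.finite_minimalPrimes_of_isNoetherianRing.sdiff).image V
  have hhom {P : Ideal S} (hP : P ∈ E) : P.IsHomogeneous 𝒮 := hI.of_mem_minimalPrimes hP.1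
  have hnle {P : Ideal S} (hP : P ∈ E) : ¬ m ≤ P := fun h =>
    hP.2 (le_antisymm (hS.le_irrelevant (hhom hP) hP.1.1.1.ne_top) h)
  refine ⟨⋃ w ∈ V '' E, (w : Set (Fin d → k)), ⟨_, hfin, rfl⟩, ?_, fun c => ?_⟩
  · rw [Set.ssubset_univ_iff]
    -- Over an infinite field, finitely many proper subspaces do not cover the space.
    have := Subspace.biUnion_ne_univ_of_top_notMem (k := k) (s := hfin.toFinset) ?_
    · simpa using this
    · rw [Set.Finite.mem_toFinset]
      rintro ⟨P, hP, htop⟩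
      have := hP.1.1.1
      refine hnle hP (irrelevant_le_of_finite_adjoin (hhom hP) ?_ hY.finite)
      rintro _ ⟨i, rfl⟩
      have h : Pi.single i 1 ∈ V P := htop ▸ Submodule.mem_top
      simpa [hV, Pi.single_apply] using h
  · have hv (i : Fin d) : Function.update X l (∑ j, c j • Y j) i ∈ 𝒮 1 := by
      by_cases h : i = l
      · subst h; simpa using hc₁ c
      · simpa [h] using hX₁ i
    rw [hS.isGradedNoetherNormalization_iff hdim hv, span_range_update]
    simp only [Set.biUnion_image, Set.mem_iUnion, SetLike.mem_coe, hV, not_exists]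
    constructor
    · intro h Q hQ
      have hQp := hQ.1.1
      have hQm : Q ≤ m := hS.le_irrelevant ((hI.sup (Ideal.homogeneous_span 𝒮 _
        (by rintro _ rfl; exact ⟨1, hc₁ c⟩))).of_mem_minimalPrimes hQ) hQp.ne_top
      obtain ⟨hIQ, hcQ⟩ := sup_le_iff.mp hQ.1.2
      obtain ⟨P, hP, hPQ⟩ := Ideal.exists_minimalPrimes_le hIQ
      by_cases hPm : P = m
      · exact hPm.ge.trans hPQ
      have hPp := hP.1.1
      have hlt : P < Q := lt_of_le_of_ne hPQ fun heq =>
        h P ⟨hP, hPm⟩ (heq ▸ hcQ (Ideal.mem_span_singleton_self _))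
      exact (Ideal.eq_of_lt_of_le_of_mem_minimalPrimes_sup_span_singleton hmX hP.1.2 hlt hQm).ge
    · intro h P hP hcP
      have := hP.1.1.1
      obtain ⟨Q, hQ, hQP⟩ := Ideal.exists_minimalPrimes_le
        (sup_le hP.1.1.2 ((Ideal.span_singleton_le_iff_mem P).mpr hcP))
      exact hnle hP ((h Q hQ).trans hQP)
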